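/- Let $(\Omega,\mathcal F)$ be a standard measurable space, let $T:\Omega\to\Omega$ be measurable, let $\mathcal I=\{A\in\mathcal F: T^{-1}A=A\}$, and let $\mathcal M(T)$ be the set of all $T$-invariant probabilities on $(\Omega,\mathcal F)$. Let $V:\mathcal F\to[0,1]$ be an upper probability, that is, $V(\emptyset)=0$, $V(\Omega)=1$, $V$ is monotone, and there is a set $\Lambda$ of probabilities on $(\Omega,\mathcal F)$, compact for the topology of pointwise convergence on $\mathcal F$, with $V(A)=\max_{P\in\Lambda}P(A)$ for all $A\in\mathcal F$. Assume that $V$ is $T$-invariant: $V(T^{-1}A)=V(A)$ for all $A\in\mathcal F$. A property holds $V$-a.s. if it holds on some $A\in\mathcal F$ with $V(A^c)=0$. Let $(f_n)_{n\ge1}$ be a sequence of $\mathcal F$-measurable functions $\Omega\to\mathbb R$ such that (i) there is $\lambda>0$ with $-\lambda n\le f_n(\omega)\le\lambda n$ for all $n\ge1$ and $\omega\in\Omega$; (ii) for all $k,n\ge1$, $f_{n+k}\le f_n+f_k\circ T^n$ $V$-a.s. Then there are bounded $\mathcal I$-measurable functions $g_n$, $n\ge 1$, and $f^*$ on $\Omega$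 such that $g_n$ is a common conditional expectation of $f_n/n$ given $\mathcal I$ for $\mathcal M(T)$, that is, $g_n=\mathbb E_P(f_n/n\mid\mathcal I)$ $P$-a.s. for every $P\in\mathcal M(T)$; $f^*(\omega)=\inf_{n\ge1}g_n(\omega)$ for every $\omega\in\Omega$; and $$\lim_{n\to\infty}\frac1n f_n(\omega)=f^*(\omega)\quad\text{for } V\text{-a.s. }\omega\in\Omega .$$ If, in addition, $V$ is ergodic (for every $A\in\mathcal I$, $V(A)\in\{0,1\}$, and $V(A)=0$ or $V(A^c)=0$), then $f^*$ is $V$-a.s. equal to a constant. -/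

import Mathlib

open MeasureTheory Filter Topology

noncomputable section

namespace UpperProb

/-- A capacity on the `σ`-algebra of `Ω`. Only the values of `μ` on measurable sets are
meaningful; no definition below ever looks at `μ A` for a non-measurable `A`. -/
structure IsCapacity {Ω : Type*} [MeasurableSpace Ω] (μ : Set Ω → ℝ) : Prop where
  empty : μ ∅ = 0
  univ : μ Set.univ = 1
  mono : ∀ A B : Set Ω, MeasurableSet A → MeasurableSet B → A ⊆ B → μ A ≤ μ B

/-- The weak* topology on the set of all probabilities on `Ω`, that is, the topology of
pointwise convergence on measurable sets: `P_α → P` iff `P_α A → P A` for all measurable `A`. -/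
abbrev weakStarTopology (Ω : Type*) [MeasurableSpace Ω] :
    TopologicalSpace (ProbabilityMeasure Ω) :=
  TopologicalSpace.induced
    (fun (P : ProbabilityMeasure Ω) (A : {A : Set Ω // MeasurableSet A}) =>
      (P : Measure Ω).real A.1)
    inferInstance

/-- An upper probability: a capacity of the form `V A = max_{P ∈ Λ} P A` with `Λ` a set of
probabilities that is compact in the weak* topology. -/
def IsUpperProbability {Ω : Type*} [MeasurableSpace Ω] (V : Set Ω → ℝ) : Prop :=
  IsCapacity V ∧
    ∃ Λ : Set (ProbabilityMeasure Ω), @IsCompact _ (weakStarTopology Ω) Λ ∧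
      ∀ A : Set Ω, MeasurableSet A →
        IsGreatest ((fun P : ProbabilityMeasure Ω => (P : Measure Ω).real A) '' Λ) (V A)

/-- The property `p` holds `μ`-almost surely: it holds on a measurable set whose complement
has capacity zero. -/
def AlmostSurely {Ω : Type*} [MeasurableSpace Ω] (μ : Set Ω → ℝ) (p : Ω → Prop) : Prop :=
  ∃ A : Set Ω, MeasurableSet A ∧ μ Aᶜ = 0 ∧ ∀ ω ∈ A, p ω

/-- The capacity `μ` is `T`-invariant. -/
def IsInvariant {Ω : Type*} [MeasurableSpace Ω] (T : Ω → Ω) (μ : Set Ω → ℝ) : Prop :=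
  ∀ A : Set Ω, MeasurableSet A → μ A = μ (T ⁻¹' A)

/-- The `T`-invariant capacity `μ` is ergodic; here `MeasurableSpace.invariants T` is the
`σ`-algebra of the measurable sets `A` with `T ⁻¹' A = A`. -/
def IsErgodic {Ω : Type*} [MeasurableSpace Ω] (T : Ω → Ω) (μ : Set Ω → ℝ) : Prop :=
  IsInvariant T μ ∧
    ∀ A : Set Ω, MeasurableSet[MeasurableSpace.invariants T] A →
      (μ A = 0 ∨ μ A = 1) ∧ (μ A = 0 ∨ μ Aᶜ = 0)

/-- The set of all `T`-invariant probabilities on `Ω`. -/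
def invariantProbabilities {Ω : Type*} [MeasurableSpace Ω] (T : Ω → Ω) :
    Set (ProbabilityMeasure Ω) :=
  {P | ∀ A : Set Ω, MeasurableSet A → (P : Measure Ω) (T ⁻¹' A) = (P : Measure Ω) A}

/-- `g` is bounded and measurable with respect to the `σ`-algebra `H`. -/
def IsBoundedMeasurable {Ω : Type*} (H : MeasurableSpace Ω) (g : Ω → ℝ) : Prop :=
  Measurable[H] g ∧ ∃ C : ℝ, ∀ ω, |g ω| ≤ C

/-- `g` is a common conditional expectation of `f` with respect to the sub-`σ`-algebra `H`
for the set `Λ` of probabilities. -/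
def IsCommonCondExp {Ω : Type*} (H : MeasurableSpace Ω) [mΩ : MeasurableSpace Ω]
    (Λ : Set (ProbabilityMeasure Ω)) (f g : Ω → ℝ) : Prop :=
  H ≤ mΩ ∧ Measurable[H] g ∧
    ∀ P ∈ Λ, (P : Measure Ω)[f|H] =ᵐ[(P : Measure Ω)] g

/-- The sequence `f 1, f 2, …` is subadditive `μ`-almost surely (`f 0` plays no role). -/
def IsSubadditiveSeq {Ω : Type*} [MeasurableSpace Ω] (T : Ω → Ω) (μ : Set Ω → ℝ)
    (f : ℕ → Ω → ℝ) : Prop :=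
  ∀ k n : ℕ, 1 ≤ k → 1 ≤ n →
    AlmostSurely μ (fun ω => f (n + k) ω ≤ f n ω + f k (T^[n] ω))

end UpperProb

end

/-! The statement reduces to classical ergodic theory under the invariant probabilities `Q ≤ V`. For
such a `Q` the `V`-a.s. hypotheses hold `Q`-a.s., so Kingman's theorem
(`ae_tendsto_div_of_subadditive`) gives `f n / n → f*` `Q`-a.s. One `g n` serves all invariant
probabilities because it is the upper limit of the Birkhoff averages of `f n / n`: this is defined
and invariant at every point, without reference to a measure (`condExp_invariants_ae_eq`).

The return to `V` is `IsUpperProbability.eq_zero_of_forall_invariant`: a set null for all these `Q`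
is `V`-null. Let `B` be the set of points visiting `A` infinitely often. Continuity from above and
invariance give `V A ≤ V B`. A maximiser `P` for the invariant set `B`, averaged along `T`, yields
an invariant `Q ≤ V` with `Q B = P B = V B`, and `Q A = 0` forces `Q B = 0`. The averaged limit is a
priori only finitely additive; domination by `V` makes it countably additive.

Kingman's theorem rests on two block decompositions of orbits: a greedy one gives `inf ∫ f n / n ≤ ∫
liminf f n / n`, and one into blocks of fixed length `m` gives `limsup f n / n ≤ g m`. Comparing
integrals then closes the gap. Birkhoff's theorem is deduced from the first of these, applied to `φ`
and `-φ`. -/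

namespace UpperProb

/-! ### Upper and lower limits of bounded real sequences. -/

section BoundedSequences

variable {u : ℕ → ℝ} {C : ℝ}

theorem isBoundedUnder_le_of_abs_le (h : ∀ n, |u n| ≤ C) : IsBoundedUnder (· ≤ ·) atTop u :=
  isBoundedUnder_of ⟨C, fun n => (abs_le.1 (h n)).2⟩

theorem isBoundedUnder_ge_of_abs_le (h : ∀ n, |u n| ≤ C) : IsBoundedUnder (· ≥ ·) atTop u :=
  isBoundedUnder_of ⟨-C, fun n => (abs_le.1 (h n)).1⟩

theorem abs_liminf_le (h : ∀ n, |u n| ≤ C) : |liminf u atTop| ≤ C := by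
  have hb := isBoundedUnder_le_of_abs_le h
  have hb' := isBoundedUnder_ge_of_abs_le h
  refine abs_le.2 ⟨?_, ?_⟩
  · exact le_liminf_of_le hb.isCoboundedUnder_ge (Eventually.of_forall fun n => (abs_le.1 (h n)).1)
  · exact (liminf_le_limsup hb hb').trans (limsup_le_of_le hb'.isCoboundedUnder_le
      (Eventually.of_forall fun n => (abs_le.1 (h n)).2))

theorem liminf_neg_eq (u : ℕ → ℝ) : liminf (fun n => -u n) atTop = -limsup u atTop := by
  simp only [liminf_eq, limsup_eq]
  rw [← Real.sSup_neg]
  congr 1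
  ext a
  simp only [Set.mem_ofPred_eq, Set.mem_neg]
  exact eventually_congr (Eventually.of_forall fun n => le_neg)

theorem abs_limsup_le (h : ∀ n, |u n| ≤ C) : |limsup u atTop| ≤ C := by
  rw [← abs_neg, ← liminf_neg_eq]
  exact abs_liminf_le fun n => by simpa using h n

/-- A bounded sequence dominated by the shift of another up to a vanishing error has the smaller
`liminf`. -/
theorem liminf_le_liminf_of_succ_le {u v e : ℕ → ℝ} (hu : ∀ n, |u n| ≤ C) (hv : ∀ n, |v n| ≤ C)
    (he : Tendsto e atTop (𝓝 0)) (h : ∀ᶠ n in atTop, u (n + 1) ≤ v n + e n) :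
    liminf u atTop ≤ liminf v atTop := by
  by_contra! hlt
  obtain ⟨a, hva, hau⟩ := exists_between hlt
  obtain ⟨b, hab, hbu⟩ := exists_between hau
  have h1 := (tendsto_add_atTop_nat 1).eventually
    (eventually_lt_of_lt_liminf hbu (isBoundedUnder_ge_of_abs_le hu))
  have h2 := he.eventually_lt_const (sub_pos.2 hab)
  refine hva.not_ge (le_liminf_of_le (isBoundedUnder_le_of_abs_le hv).isCoboundedUnder_ge ?_)
  filter_upwards [h, h1, h2] with n h h1 h2
  linarith

end BoundedSequences

/-! ### Block decompositions for a subadditive cocycle along one orbit. -/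

section Deterministic

variable {F : ℕ → ℕ → ℝ} {C : ℝ}

/-- Greedy decomposition of an orbit segment into good blocks of length at most `N` and single
bad points. -/
theorem le_sum_of_exists_block
    (hsub : ∀ j k n, 1 ≤ k → 1 ≤ n → F j (n + k) ≤ F j n + F (j + n) k)
    (hF : ∀ j n, 1 ≤ n → F j n ≤ C * n) {ψ : ℕ → ℝ} {c ε : ℝ} {N : ℕ} (hC : 0 ≤ C)
    (hψ : ∀ j, -C ≤ ψ j) (hψc : ∀ j, c ≤ ψ j) (hε : 0 ≤ ε)
    (hblock : ∀ j, ψ j = C ∨ ∃ l : ℕ, 1 ≤ l ∧ l ≤ N ∧ F j l ≤ l * (c + ε)) (n : ℕ) (hn : 1 ≤ n)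
    (j : ℕ) : F j n ≤ ∑ i ∈ Finset.range n, ψ (j + i) + ε * n + 2 * C * N := by
  induction n using Nat.strong_induction_on generalizing j with
  | _ n ih =>
    have hlow : ∀ (d : ℝ) (j l : ℕ), (∀ i, d ≤ ψ i) →
        d * l ≤ ∑ i ∈ Finset.range l, ψ (j + i) := fun d j l hd => by
      simpa [mul_comm] using Finset.card_nsmul_le_sum (Finset.range l) (fun i => ψ (j + i)) d
        fun i _ => hd _
    rcases le_or_gt n N with hnN | hnN
    · have h1 := hlow (-C) j n hψ
      have h2 := hF j n hn
      have h3 : C * n ≤ C * N := by gcongr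
      nlinarith [mul_nonneg hε (Nat.cast_nonneg (α := ℝ) n)]
    have step : ∀ l : ℕ, 1 ≤ l → l < n →
        F j l ≤ ∑ i ∈ Finset.range l, ψ (j + i) + ε * l →
        F j n ≤ ∑ i ∈ Finset.range n, ψ (j + i) + ε * n + 2 * C * N := fun l h1 h2 h3 => by
      have h4 := hsub j (n - l) l (by omega) h1
      have h5 := ih (n - l) (by omega) (by omega) (j + l)
      rw [show n = l + (n - l) by omega, Finset.sum_range_add]
      simp only [← add_assoc] at h5 ⊢
      push_cast
      linarith
    rcases hblock j with hb | ⟨l, hl1, hlN, hl⟩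
    · rcases eq_or_lt_of_le hn with rfl | hn1
      · have := hF j 1 le_rfl
        have h0 : 0 ≤ C * N := by positivity
        simp only [Finset.sum_range_one, add_zero, hb, Nat.cast_one, mul_one] at this ⊢
        linarith
      · refine step 1 le_rfl hn1 ?_
        have := hF j 1 le_rfl
        simp only [Finset.sum_range_one, add_zero, hb, Nat.cast_one, mul_one] at this ⊢
        linarith
    · refine step l hl1 (by omega) ?_
      have := hlow c j l hψc
      linarith

/-- A subadditive cocycle is dominated by the sum of its `m`-blocks along the orbit. -/
theorem sum_le_sum_block
    (hsub : ∀ j k n, 1 ≤ k → 1 ≤ n → F j (n + k) ≤ F j n + F (j + n) k) (hC : 0 ≤ C)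
    (hF : ∀ j n, 1 ≤ n → |F j n| ≤ C * n) {m : ℕ} (hm : 1 ≤ m) (n : ℕ) (hn : 1 ≤ n) (j : ℕ) :
    ∑ r ∈ Finset.range m, F (j + r) n ≤
      ∑ i ∈ Finset.range n, F (j + i) m + 2 * C * m * m := by
  induction n using Nat.strong_induction_on generalizing j with
  | _ n ih =>
    rcases le_or_gt n m with hnm | hnm
    · have h1 : ∑ r ∈ Finset.range m, F (j + r) n ≤ m * (C * n) := by
        simpa using Finset.sum_le_card_nsmul (Finset.range m) (fun r => F (j + r) n) (C * n)
          fun r _ => (abs_le.1 (hF _ _ hn)).2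
      have h2 : n * -(C * m) ≤ ∑ i ∈ Finset.range n, F (j + i) m := by
        simpa using Finset.card_nsmul_le_sum (Finset.range n) (fun r => F (j + r) m) (-(C * m))
          fun r _ => (abs_le.1 (hF _ _ hm)).1
      have h3 : C * m * n ≤ C * m * m := by gcongr
      nlinarith
    · have h1 := ih (n - m) (by omega) (by omega) (j + m)
      have h2 : ∑ r ∈ Finset.range m, F (j + r) n ≤
          ∑ r ∈ Finset.range m, F (j + r) m + ∑ r ∈ Finset.range m, F (j + m + r) (n - m) := by
        rw [← Finset.sum_add_distrib]
        refine Finset.sum_le_sum fun r _ => ?_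
        have := hsub (j + r) (n - m) m (by omega) hm
        rwa [show m + (n - m) = n by omega, show j + r + m = j + m + r by ring] at this
      rw [show n = m + (n - m) by omega, Finset.sum_range_add]
      rw [show m + (n - m) = n by omega]
      simp only [← add_assoc]
      linarith

/-- For each offset `r < m`, cut `n + m` into pieces of lengths `r`, `n`, `m - r`. The outer two
cost at most `C * m`; summing over `r` adds `C * m * m` to the error of `sum_le_sum_block`. -/
theorem mul_le_sum_block
    (hsub : ∀ j k n, 1 ≤ k → 1 ≤ n → F j (n + k) ≤ F j n + F (j + n) k) (hC : 0 ≤ C)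
    (hF : ∀ j n, 1 ≤ n → |F j n| ≤ C * n) {m : ℕ} (hm : 1 ≤ m) (n : ℕ) (hn : 1 ≤ n) :
    m * F 0 (n + m) ≤ ∑ i ∈ Finset.range n, F i m + 3 * C * m * m := by
  have h1 : ∀ r ∈ Finset.range m, F 0 (n + m) - C * m ≤ F r n := fun r hr => by
    have hr := Finset.mem_range.1 hr
    have h2 := hsub r (m - r) n (by omega) hn
    have h3 := (abs_le.1 (hF (r + n) (m - r) (by omega))).2
    rw [Nat.cast_sub hr.le] at h3
    rcases Nat.eq_zero_or_pos r with rfl | h0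
    · simp only [tsub_zero, zero_add, Nat.cast_zero] at h2 h3
      linarith
    · have h4 := hsub 0 (n + (m - r)) r (by omega) h0
      have h5 := (abs_le.1 (hF 0 r h0)).2
      rw [show r + (n + (m - r)) = n + m by omega, zero_add] at h4
      linarith
  have h2 := Finset.card_nsmul_le_sum _ _ _ h1
  have h3 := sum_le_sum_block hsub hC hF hm n hn 0
  simp only [Finset.card_range, nsmul_eq_mul, zero_add] at h2 h3
  linarith

end Deterministic

/-! ### The lower limit of a subadditive sequence under an invariant measure. -/

section Ergodic

variable {Ω : Type*} [MeasurableSpace Ω] {μ : Measure Ω} {T : Ω → Ω}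

theorem ae_forall_iterate (hT : MeasurePreserving T μ μ) {p : Ω → Prop} (hp : ∀ᵐ ω ∂μ, p ω) :
    ∀ᵐ ω ∂μ, ∀ j : ℕ, p (T^[j] ω) :=
  ae_all_iff.2 fun j => (hT.iterate j).quasiMeasurePreserving.ae hp

theorem integrable_of_abs_le [IsFiniteMeasure μ] {φ : Ω → ℝ} {C : ℝ} (hφ : Measurable φ)
    (h : ∀ ω, |φ ω| ≤ C) : Integrable φ μ :=
  Integrable.of_bound hφ.aestronglyMeasurable C (Eventually.of_forall h)

theorem integral_comp_of_measurePreserving (hT : MeasurePreserving T μ μ) {φ : Ω → ℝ}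
    (hφ : Measurable φ) : ∫ ω, φ (T ω) ∂μ = ∫ ω, φ ω ∂μ := by
  conv_rhs => rw [← hT.map_eq]
  exact (integral_map hT.aemeasurable hφ.aestronglyMeasurable).symm

/-- `φ` and `φ ∘ T` have equal integrals, so the inequality between them cannot be strict on a set
of positive measure. -/
theorem ae_eq_comp_of_le_comp [IsFiniteMeasure μ] (hT : MeasurePreserving T μ μ) {φ : Ω → ℝ}
    {C : ℝ} (hφ : Measurable φ) (hC : ∀ ω, |φ ω| ≤ C) (h : ∀ᵐ ω ∂μ, φ ω ≤ φ (T ω)) :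
    ∀ᵐ ω ∂μ, φ (T ω) = φ ω := by
  have := (integral_eq_iff_of_ae_le (integrable_of_abs_le hφ hC)
    (integrable_of_abs_le (hφ.comp hT.measurable) fun ω => hC (T ω)) h).1
    (integral_comp_of_measurePreserving hT hφ).symm
  exact this.mono fun ω h => h.symm

variable {f : ℕ → Ω → ℝ} {C : ℝ}

/-- At `n = 0` the quotient is `0`, so nothing is needed of `f 0`. -/
theorem measurable_div_natCast (hf : ∀ n, 1 ≤ n → Measurable (f n)) (n : ℕ) :
    Measurable fun ω => f n ω / n := by
  rcases Nat.eq_zero_or_pos n with rfl | h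
  · simp
  · exact (hf n h).div_const _

theorem abs_div_natCast_le (hC : 0 ≤ C) {a : ℕ → ℝ} (h : ∀ n, 1 ≤ n → |a n| ≤ C * n) (n : ℕ) :
    |a n / n| ≤ C := by
  rcases Nat.eq_zero_or_pos n with rfl | h0
  · simpa
  · have : (0 : ℝ) < n := by exact_mod_cast h0
    rw [abs_div, abs_of_pos this, div_le_iff₀ this]
    exact h n h0

theorem ae_subadditive_along_orbit (hT : MeasurePreserving T μ μ)
    (hsub : ∀ k n, 1 ≤ k → 1 ≤ n → ∀ᵐ ω ∂μ, f (n + k) ω ≤ f n ω + f k (T^[n] ω)) :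
    ∀ᵐ ω ∂μ, ∀ j k n, 1 ≤ k → 1 ≤ n →
      f (n + k) (T^[j] ω) ≤ f n (T^[j] ω) + f k (T^[j + n] ω) := by
  have h : ∀ᵐ ω ∂μ, ∀ k n, 1 ≤ k → 1 ≤ n → f (n + k) ω ≤ f n ω + f k (T^[n] ω) := by
    simpa only [ae_all_iff] using hsub
  filter_upwards [ae_forall_iterate hT h] with ω hω j k n hk hn
  have := hω j k n hk hn
  rwa [← Function.iterate_add_apply, add_comm n j] at this

theorem ae_liminf_comp_eq [IsFiniteMeasure μ] (hT : MeasurePreserving T μ μ) (hC : 0 ≤ C)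
    (hf : ∀ n, 1 ≤ n → Measurable (f n)) (hb : ∀ n, 1 ≤ n → ∀ ω, |f n ω| ≤ C * n)
    (hsub : ∀ k n, 1 ≤ k → 1 ≤ n → ∀ᵐ ω ∂μ, f (n + k) ω ≤ f n ω + f k (T^[n] ω)) :
    ∀ᵐ ω ∂μ, liminf (fun n => f n (T ω) / n) atTop = liminf (fun n => f n ω / n) atTop := by
  have hu : ∀ ω n, |f n ω / n| ≤ C := fun ω => abs_div_natCast_le hC fun n hn => hb n hn ω
  refine ae_eq_comp_of_le_comp hT (φ := fun ω => liminf (fun n => f n ω / n) atTop)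
    (Measurable.liminf (measurable_div_natCast hf)) (C := C) (fun ω => abs_liminf_le (hu ω)) ?_
  filter_upwards [ae_subadditive_along_orbit hT hsub] with ω hω
  -- In the error `2 * C / n`, one `C` bounds `f 1` and the other pays for replacing the denominator
  -- `n + 1` by `n`.
  refine liminf_le_liminf_of_succ_le (hu ω) (hu (T ω)) (e := fun n : ℕ => 2 * C / n)
    (tendsto_const_nhds.div_atTop tendsto_natCast_atTop_atTop) ?_
  filter_upwards [eventually_ge_atTop 1] with n hn
  have h1 := hω 0 n 1 hn le_rfl
  have h2 := (abs_le.1 (hb 1 le_rfl ω)).2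
  have h3 := (abs_le.1 (hb n hn (T ω))).1
  simp only [Function.iterate_zero, id, zero_add, Function.iterate_one, Nat.cast_one,
    mul_one, add_comm 1 n] at h1 h2
  have hn' : (1 : ℝ) ≤ n := by exact_mod_cast hn
  push_cast
  rw [← add_div, div_le_div_iff₀ (by positivity) (by positivity)]
  nlinarith

open Classical in
/-- The maximal-inequality half of the subadditive ergodic theorem, in integrated form. -/
theorem exists_integral_div_le [IsFiniteMeasure μ] (hT : MeasurePreserving T μ μ) (hC : 0 ≤ C)
    (hf : ∀ n, 1 ≤ n → Measurable (f n)) (hb : ∀ n, 1 ≤ n → ∀ ω, |f n ω| ≤ C * n)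
    (hsub : ∀ k n, 1 ≤ k → 1 ≤ n → ∀ᵐ ω ∂μ, f (n + k) ω ≤ f n ω + f k (T^[n] ω))
    {δ : ℝ} (hδ : 0 < δ) :
    ∃ n, 1 ≤ n ∧ ∫ ω, f n ω / n ∂μ ≤ ∫ ω, liminf (fun n => f n ω / n) atTop ∂μ + δ := by
  set h : Ω → ℝ := fun ω => liminf (fun n => f n ω / n) atTop with hdef
  have hu : ∀ ω n, |f n ω / n| ≤ C := fun ω => abs_div_natCast_le hC fun n hn => hb n hn ω
  have hm : Measurable h := Measurable.liminf (measurable_div_natCast hf)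
  have hh : ∀ ω, |h ω| ≤ C := fun ω => abs_liminf_le (hu ω)
  set M := μ.real Set.univ with hM
  have hM0 : 0 ≤ M := measureReal_nonneg
  obtain ⟨ε, hε, hεM⟩ : ∃ ε : ℝ, 0 < ε ∧ 2 * ε * M ≤ δ / 2 := by
    refine ⟨δ / (4 * (M + 1)), by positivity, ?_⟩
    rw [show 2 * (δ / (4 * (M + 1))) * M = δ / 2 * (M / (M + 1)) by field_simp; ring]
    exact mul_le_of_le_one_right (by positivity) ((div_le_one (by positivity)).2 (by linarith))
  let good : ℕ → Ω → Prop := fun N ω => ∃ l : ℕ, 1 ≤ l ∧ l ≤ N ∧ f l ω ≤ l * (h ω + ε)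
  -- Every point is good for large `N` by definition of the lower limit, so `ψ N → h` pointwise and
  -- boundedly.
  let ψ : ℕ → Ω → ℝ := fun N ω => if good N ω then h ω else C
  have hgm : ∀ N, MeasurableSet {ω | good N ω} := fun N => by
    have : {ω | good N ω} = ⋃ l ∈ Finset.Icc 1 N, {ω | f l ω ≤ l * (h ω + ε)} := by
      ext ω; simp [good, and_assoc]
    rw [this]
    refine Finset.measurableSet_biUnion _ fun l hl => measurableSet_le (hf l ?_) ?_
    · exact (Finset.mem_Icc.1 hl).1
    · exact (hm.add_const _).const_mul _
  have hψm : ∀ N, Measurable (ψ N) := fun N => Measurable.ite (hgm N) hm measurable_const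
  have hψC : ∀ N ω, |ψ N ω| ≤ C := fun N ω => by
    simp only [ψ]
    split_ifs
    · exact hh ω
    · rw [abs_of_nonneg hC]
  have hψlim : Tendsto (fun N => ∫ ω, ψ N ω ∂μ) atTop (𝓝 (∫ ω, h ω ∂μ)) := by
    refine tendsto_integral_of_dominated_convergence (fun _ => C)
      (fun N => (hψm N).aestronglyMeasurable) (integrable_const _)
      (fun N => Eventually.of_forall (hψC N)) (Eventually.of_forall fun ω => ?_)
    have hfreq : ∃ᶠ n in atTop, f n ω / n < h ω + ε :=
      frequently_lt_of_liminf_lt (isBoundedUnder_le_of_abs_le (hu ω)).isCoboundedUnder_ge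
        (by simp only [hdef]; linarith)
    obtain ⟨l, hl, hl1⟩ := (hfreq.and_eventually (eventually_ge_atTop 1)).exists
    have hl0 : (0 : ℝ) < l := by exact_mod_cast hl1
    refine tendsto_const_nhds.congr' ?_
    filter_upwards [eventually_ge_atTop l] with N hN
    have : good N ω := ⟨l, hl1, hN, by rw [div_lt_iff₀ hl0] at hl; linarith⟩
    simp [ψ, this]
  obtain ⟨N, hN⟩ := (hψlim.eventually_lt_const
    (show ∫ ω, h ω ∂μ < ∫ ω, h ω ∂μ + δ / 2 by linarith)).exists
  -- This `n` absorbs the boundary cost `2 * C * N` into a second `ε * n`.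
  obtain ⟨n, hn⟩ := exists_nat_ge (max 1 (2 * C * N / ε))
  have hn1 : (1 : ℝ) ≤ n := (le_max_left _ _).trans hn
  have hn0 : (0 : ℝ) < n := by linarith
  have hn1' : 1 ≤ n := by exact_mod_cast hn1
  have hnε : 2 * C * N ≤ ε * n := by
    have := (le_max_right _ _).trans hn
    rw [div_le_iff₀ hε] at this
    linarith
  refine ⟨n, hn1', ?_⟩
  have key : ∀ᵐ ω ∂μ, f n ω ≤ ∑ i ∈ Finset.range n, ψ N (T^[i] ω) + 2 * ε * n := by
    filter_upwards [ae_subadditive_along_orbit hT hsub,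
      ae_forall_iterate hT (ae_liminf_comp_eq hT hC hf hb hsub)] with ω hω hinv
    -- Invariance of `h` lets a single constant `c = h ω` serve along the whole orbit.
    have hinv' : ∀ j, h (T^[j] ω) = h ω := fun j => by
      induction j with
      | zero => rfl
      | succ j ih => rw [Function.iterate_succ_apply', ← ih]; exact hinv j
    have := le_sum_of_exists_block (F := fun j n => f n (T^[j] ω)) hω
      (fun j n hn => (abs_le.1 (hb n hn _)).2) (ψ := fun j => ψ N (T^[j] ω)) (c := h ω)
      (ε := ε) (N := N) hC (fun j => (abs_le.1 (hψC _ _)).1) (fun j => ?_) hε.le (fun j => ?_)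
      n hn1' 0
    · simp only [Function.iterate_zero, id, zero_add] at this
      linarith
    · simp only [ψ]
      split_ifs
      · exact (hinv' j).ge
      · exact (abs_le.1 (hh ω)).2
    · by_cases hg : good N (T^[j] ω)
      · right
        simpa only [good, hinv'] using hg
      · left
        simp [ψ, hg]
  have hsum : Integrable (fun ω => ∑ i ∈ Finset.range n, ψ N (T^[i] ω)) μ :=
    integrable_finsetSum _ fun i _ => integrable_of_abs_le
      ((hψm N).comp (hT.iterate i).measurable) fun ω => hψC N _
  have h1 : ∫ ω, f n ω ∂μ ≤ n * ∫ ω, ψ N ω ∂μ + 2 * ε * n * M := by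
    refine (integral_mono_ae (integrable_of_abs_le (hf n hn1') (hb n hn1'))
      (hsum.add (integrable_const _)) key).trans_eq ?_
    rw [integral_add' hsum (integrable_const _), integral_finsetSum]
    · rw [Finset.sum_congr rfl fun i _ =>
        integral_comp_of_measurePreserving (hT.iterate i) (hψm N)]
      simp [hM, mul_comm]
    · exact fun i _ => integrable_of_abs_le
        ((hψm N).comp (hT.iterate i).measurable) fun ω => hψC N _
  rw [integral_div, div_le_iff₀ hn0]
  nlinarith

end Ergodic

/-! ### Birkhoff's and Kingman's theorems. -/

section PointwiseErgodic

variable {Ω : Type*} {T : Ω → Ω} {φ : Ω → ℝ} {C : ℝ}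

/-- The upper limit of the Birkhoff averages of `φ` along `T`. -/
noncomputable def limsupAverage (T : Ω → Ω) (φ : Ω → ℝ) (ω : Ω) : ℝ :=
  limsup (fun n => birkhoffAverage ℝ T φ n ω) atTop

theorem abs_birkhoffSum_le (hb : ∀ ω, |φ ω| ≤ C) (n : ℕ) (ω : Ω) :
    |birkhoffSum T φ n ω| ≤ C * n := by
  refine (Finset.abs_sum_le_sum_abs _ _).trans ?_
  simpa [mul_comm] using Finset.sum_le_card_nsmul (Finset.range n) (fun i => |φ (T^[i] ω)|) C
    fun i _ => hb _

theorem birkhoffAverage_eq_div (n : ℕ) (ω : Ω) :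
    birkhoffAverage ℝ T φ n ω = birkhoffSum T φ n ω / n := by
  rw [birkhoffAverage, smul_eq_mul, div_eq_inv_mul]

theorem abs_birkhoffAverage_le (hC : 0 ≤ C) (hb : ∀ ω, |φ ω| ≤ C) (ω : Ω) (n : ℕ) :
    |birkhoffAverage ℝ T φ n ω| ≤ C := by
  rw [birkhoffAverage_eq_div]
  exact abs_div_natCast_le hC (fun n _ => abs_birkhoffSum_le hb n ω) n

theorem abs_limsupAverage_le (hC : 0 ≤ C) (hb : ∀ ω, |φ ω| ≤ C) (ω : Ω) :
    |limsupAverage T φ ω| ≤ C :=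
  abs_limsup_le (abs_birkhoffAverage_le hC hb ω)

/-- Shifting the starting point changes the `n`-th average by `O(1/n)`. Equality at every point, not
merely almost everywhere, yields measurability for the invariant σ-algebra itself. -/
theorem limsupAverage_comp (hC : 0 ≤ C) (hb : ∀ ω, |φ ω| ≤ C) (ω : Ω) :
    limsupAverage T φ (T ω) = limsupAverage T φ ω := by
  have ht : Tendsto (fun n => birkhoffAverage ℝ T φ n (T ω) - birkhoffAverage ℝ T φ n ω)
      atTop (𝓝 0) := by
    refine tendsto_birkhoffAverage_apply_sub_birkhoffAverage' ℝ ?_ T ω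
    exact (Metric.isBounded_closedBall (x := (0 : ℝ)) (r := C)).subset
      (Set.range_subset_iff.2 fun ω => by simpa using hb ω)
  have key : ∀ x y : Ω, Tendsto
      (fun n => birkhoffAverage ℝ T φ n y - birkhoffAverage ℝ T φ n x) atTop (𝓝 0) →
      limsupAverage T φ x ≤ limsupAverage T φ y := fun x y h => by
    have hx := abs_birkhoffAverage_le (T := T) hC hb x
    have hy := abs_birkhoffAverage_le (T := T) hC hb y
    refine le_of_forall_pos_lt_add fun ε hε => ?_
    have h1 : ∀ᶠ n in atTop, birkhoffAverage ℝ T φ n y < limsupAverage T φ y + ε / 3 :=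
      eventually_lt_of_limsup_lt (by rw [limsupAverage]; linarith)
        (isBoundedUnder_le_of_abs_le hy)
    have h2 := h.eventually_const_lt (show -(ε / 3) < 0 by linarith)
    refine (limsup_le_of_le (a := limsupAverage T φ y + 2 * (ε / 3))
      (isBoundedUnder_ge_of_abs_le hx).isCoboundedUnder_le ?_).trans_lt (by linarith)
    filter_upwards [h1, h2] with n h1 h2
    linarith
  refine le_antisymm (key _ _ ?_) (key _ _ ht)
  simpa using ht.neg

theorem liminf_average_le (hC : 0 ≤ C) (hb : ∀ ω, |φ ω| ≤ C) (ω : Ω) :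
    liminf (fun n => birkhoffAverage ℝ T φ n ω) atTop ≤ limsupAverage T φ ω :=
  have h := abs_birkhoffAverage_le (T := T) hC hb ω
  liminf_le_limsup (isBoundedUnder_le_of_abs_le h) (isBoundedUnder_ge_of_abs_le h)

variable [MeasurableSpace Ω] {μ : Measure Ω} {f : ℕ → Ω → ℝ}

theorem measurable_birkhoffSum (hT : Measurable T) (hφ : Measurable φ) (n : ℕ) :
    Measurable (birkhoffSum T φ n) :=
  Finset.measurable_fun_sum _ fun i _ => hφ.comp (hT.iterate i)

theorem measurable_birkhoffAverage (hT : Measurable T) (hφ : Measurable φ) (n : ℕ) :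
    Measurable (birkhoffAverage ℝ T φ n) :=
  (measurable_birkhoffSum hT hφ n).const_smul (n : ℝ)⁻¹

theorem measurable_invariants_of_comp_eq {g : Ω → ℝ} (hg : Measurable g)
    (h : ∀ ω, g (T ω) = g ω) : Measurable[MeasurableSpace.invariants T] g :=
  MeasurableSpace.measurable_invariants_dom.2 ⟨hg, fun s _ => by
    rw [show g ∘ T = g from funext h]⟩

theorem measurable_limsupAverage (hT : Measurable T) (hφ : Measurable φ) :
    Measurable (limsupAverage T φ) :=
  Measurable.limsup (measurable_birkhoffAverage hT hφ)

theorem measurable_invariants_limsupAverage (hT : Measurable T) (hφ : Measurable φ) (hC : 0 ≤ C)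
    (hb : ∀ ω, |φ ω| ≤ C) : Measurable[MeasurableSpace.invariants T] (limsupAverage T φ) :=
  measurable_invariants_of_comp_eq (measurable_limsupAverage hT hφ) (limsupAverage_comp hC hb)

/-- Birkhoff sums are an additive cocycle, and every average has integral `∫ φ`. -/
theorem integral_le_integral_liminf_average [IsFiniteMeasure μ] (hT : MeasurePreserving T μ μ)
    (hφ : Measurable φ) (hC : 0 ≤ C) (hb : ∀ ω, |φ ω| ≤ C) :
    ∫ ω, φ ω ∂μ ≤ ∫ ω, liminf (fun n => birkhoffAverage ℝ T φ n ω) atTop ∂μ := by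
  refine le_of_forall_pos_le_add fun δ hδ => ?_
  obtain ⟨n, hn, h⟩ := exists_integral_div_le (f := birkhoffSum T φ) hT hC
    (fun n _ => measurable_birkhoffSum hT.measurable hφ n) (fun n _ => abs_birkhoffSum_le hb n)
    (fun k n _ _ => Eventually.of_forall fun ω => (birkhoffSum_add T φ n k ω).le) hδ
  simp only [← birkhoffAverage_eq_div] at h
  refine le_trans (le_of_eq ?_) h
  have hn0 : (n : ℝ) ≠ 0 := by positivity
  simp only [birkhoffAverage_eq_div, birkhoffSum]
  rw [integral_div, integral_finsetSum (f := fun i ω => φ (T^[i] ω)) _ fun i _ =>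
    integrable_of_abs_le (hφ.comp (hT.iterate i).measurable) fun ω => hb _,
    Finset.sum_congr rfl fun i _ => integral_comp_of_measurePreserving (hT.iterate i) hφ]
  simp [hn0]

theorem integral_limsupAverage_le [IsFiniteMeasure μ] (hT : MeasurePreserving T μ μ)
    (hφ : Measurable φ) (hC : 0 ≤ C) (hb : ∀ ω, |φ ω| ≤ C) :
    ∫ ω, limsupAverage T φ ω ∂μ ≤ ∫ ω, φ ω ∂μ := by
  have h := integral_le_integral_liminf_average (φ := fun ω => -φ ω) hT hφ.neg hC (C := C)
    fun ω => by simpa using hb ω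
  have hneg : ∀ n ω, birkhoffAverage ℝ T (fun ω => -φ ω) n ω = -birkhoffAverage ℝ T φ n ω :=
    fun n ω => by simp [birkhoffAverage, birkhoffSum]
  simp only [hneg, liminf_neg_eq, integral_neg] at h
  exact neg_le_neg_iff.1 h

theorem integrable_liminf_average [IsFiniteMeasure μ] (hT : Measurable T)
    (hφ : Measurable φ) (hC : 0 ≤ C) (hb : ∀ ω, |φ ω| ≤ C) :
    Integrable (fun ω => liminf (fun n => birkhoffAverage ℝ T φ n ω) atTop) μ :=
  integrable_of_abs_le (Measurable.liminf (measurable_birkhoffAverage hT hφ))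
    fun ω => abs_liminf_le (abs_birkhoffAverage_le hC hb ω)

theorem integrable_limsupAverage [IsFiniteMeasure μ] (hT : Measurable T)
    (hφ : Measurable φ) (hC : 0 ≤ C) (hb : ∀ ω, |φ ω| ≤ C) :
    Integrable (limsupAverage T φ) μ :=
  integrable_of_abs_le (measurable_limsupAverage hT hφ) (abs_limsupAverage_le hC hb)

theorem integral_limsupAverage [IsFiniteMeasure μ] (hT : MeasurePreserving T μ μ)
    (hφ : Measurable φ) (hC : 0 ≤ C) (hb : ∀ ω, |φ ω| ≤ C) :
    ∫ ω, limsupAverage T φ ω ∂μ = ∫ ω, φ ω ∂μ :=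
  le_antisymm (integral_limsupAverage_le hT hφ hC hb)
    ((integral_le_integral_liminf_average hT hφ hC hb).trans
      (integral_mono (integrable_liminf_average hT.measurable hφ hC hb)
        (integrable_limsupAverage hT.measurable hφ hC hb) (liminf_average_le hC hb)))

/-- The pointwise ergodic theorem for bounded functions: convergence of the averages. -/
theorem ae_tendsto_birkhoffAverage [IsFiniteMeasure μ] (hT : MeasurePreserving T μ μ)
    (hφ : Measurable φ) (hC : 0 ≤ C) (hb : ∀ ω, |φ ω| ≤ C) :
    ∀ᵐ ω ∂μ, Tendsto (fun n => birkhoffAverage ℝ T φ n ω) atTop (𝓝 (limsupAverage T φ ω)) := by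
  have hlo := integrable_liminf_average (μ := μ) hT.measurable hφ hC hb
  have hup := integrable_limsupAverage (μ := μ) hT.measurable hφ hC hb
  have heq := (integral_eq_iff_of_ae_le hlo hup
    (Eventually.of_forall (liminf_average_le hC hb))).1
    (le_antisymm (integral_mono hlo hup (liminf_average_le hC hb))
      ((integral_limsupAverage_le hT hφ hC hb).trans
        (integral_le_integral_liminf_average hT hφ hC hb)))
  filter_upwards [heq] with ω hω
  have h := abs_birkhoffAverage_le (T := T) hC hb ω
  exact tendsto_of_liminf_eq_limsup hω rfl (isBoundedUnder_le_of_abs_le h)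
    (isBoundedUnder_ge_of_abs_le h)

/-- The pointwise ergodic theorem for bounded functions: identification of the limit. -/
theorem condExp_invariants_ae_eq [IsFiniteMeasure μ] (hT : MeasurePreserving T μ μ)
    (hφ : Measurable φ) (hC : 0 ≤ C) (hb : ∀ ω, |φ ω| ≤ C) :
    μ[φ|MeasurableSpace.invariants T] =ᵐ[μ] limsupAverage T φ := by
  refine (ae_eq_condExp_of_forall_setIntegral_eq (MeasurableSpace.invariants_le T)
    (integrable_of_abs_le hφ hb)
    (fun s _ _ => (integrable_limsupAverage hT.measurable hφ hC hb).integrableOn)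
    (fun s hs _ => ?_)
    (measurable_invariants_limsupAverage hT.measurable hφ hC
      hb).stronglyMeasurable.aestronglyMeasurable).symm
  -- `T` also preserves `μ` restricted to an invariant set, so the set integrals are again an
  -- instance of `integral_limsupAverage`.
  have h := hT.restrict_preimage (MeasurableSpace.measurableSet_invariants.1 hs).1
  rw [(MeasurableSpace.measurableSet_invariants.1 hs).2] at h
  exact integral_limsupAverage h hφ hC hb

/-- The subadditive ergodic theorem for sequences of linear growth. -/
theorem ae_tendsto_div_of_subadditive [IsFiniteMeasure μ] (hT : MeasurePreserving T μ μ)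
    (hC : 0 ≤ C) (hf : ∀ n, 1 ≤ n → Measurable (f n))
    (hb : ∀ n, 1 ≤ n → ∀ ω, |f n ω| ≤ C * n)
    (hsub : ∀ k n, 1 ≤ k → 1 ≤ n → ∀ᵐ ω ∂μ, f (n + k) ω ≤ f n ω + f k (T^[n] ω))
    {F : Ω → ℝ} (hF : Measurable F) (hFC : ∀ ω, |F ω| ≤ C)
    (hglb : ∀ ω, IsGLB ((fun n : ℕ => limsupAverage T (fun ω => f n ω / n) ω) '' Set.Ici 1)
      (F ω)) :
    ∀ᵐ ω ∂μ, Tendsto (fun n => f n ω / n) atTop (𝓝 (F ω)) := by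
  have hu : ∀ ω n, |f n ω / n| ≤ C := fun ω => abs_div_natCast_le hC fun n hn => hb n hn ω
  have hum := measurable_div_natCast hf
  have hav : ∀ᵐ ω ∂μ, ∀ m : ℕ, Tendsto (fun n => birkhoffAverage ℝ T (fun ω => f m ω / m) n ω)
      atTop (𝓝 (limsupAverage T (fun ω => f m ω / m) ω)) :=
    ae_all_iff.2 fun m => ae_tendsto_birkhoffAverage hT (hum m) hC fun ω => hu ω m
  have hupper : ∀ᵐ ω ∂μ, limsup (fun n => f n ω / n) atTop ≤ F ω := by
    filter_upwards [hav, ae_subadditive_along_orbit hT hsub] with ω hω hs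
    refine (hglb ω).2 ?_
    rintro _ ⟨m, hm, rfl⟩
    have hm1 : 1 ≤ m := hm
    have hm0 : (0 : ℝ) < m := by exact_mod_cast hm1
    -- The right side of `mul_le_sum_block`, divided by `m * (n + m)`.
    have hlim : Tendsto (fun n : ℕ => birkhoffAverage ℝ T (fun ω => f m ω / m) n ω *
        (n / (n + m)) + 3 * C * m / (n + m)) atTop
        (𝓝 (limsupAverage T (fun ω => f m ω / m) ω * 1 + 0)) :=
      ((hω m).mul (tendsto_natCast_div_add_atTop (m : ℝ))).add
        (tendsto_const_nhds.div_atTop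
          (tendsto_atTop_add_const_right _ _ tendsto_natCast_atTop_atTop))
    rw [mul_one, add_zero] at hlim
    change _ ≤ limsupAverage T (fun ω => f m ω / m) ω
    rw [← limsup_nat_add _ m, ← hlim.limsup_eq]
    refine limsup_le_limsup ?_
      (isBoundedUnder_ge_of_abs_le fun n => hu ω (n + m)).isCoboundedUnder_le
      hlim.isBoundedUnder_le
    filter_upwards [eventually_ge_atTop 1] with n hn
    have h1 := mul_le_sum_block (F := fun j n => f n (T^[j] ω)) hs hC
      (fun j n hn => hb n hn _) hm1 n hn
    have hn0 : (0 : ℝ) < n := by exact_mod_cast hn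
    have h2 : ∑ i ∈ Finset.range n, f m (T^[i] ω) =
        m * (n * birkhoffAverage ℝ T (fun ω => f m ω / m) n ω) := by
      rw [birkhoffAverage_eq_div, birkhoffSum, ← Finset.sum_div]
      field_simp
    simp only [Function.iterate_zero, id, h2] at h1
    rw [← mul_div_assoc, ← add_div, Nat.cast_add]
    gcongr
    nlinarith
  have hlow : Measurable fun ω => liminf (fun n => f n ω / n) atTop := Measurable.liminf hum
  have hlowC : ∀ ω, |liminf (fun n => f n ω / n) atTop| ≤ C := fun ω => abs_liminf_le (hu ω)
  have hle : ∀ᵐ ω ∂μ, liminf (fun n => f n ω / n) atTop ≤ F ω := by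
    filter_upwards [hupper] with ω hω
    exact (liminf_le_limsup (isBoundedUnder_le_of_abs_le (hu ω))
      (isBoundedUnder_ge_of_abs_le (hu ω))).trans hω
  -- `F ≤ g n` and `∫ g n = ∫ f n / n`, which is within `δ` of the bound for a suitable `n`. With
  -- `hle` this forces equality a.e.
  have hint : ∫ ω, F ω ∂μ ≤ ∫ ω, liminf (fun n => f n ω / n) atTop ∂μ := by
    refine le_of_forall_pos_le_add fun δ hδ => ?_
    obtain ⟨n, hn, h⟩ := exists_integral_div_le hT hC hf hb hsub hδ
    refine le_trans ?_ h
    rw [← integral_limsupAverage hT (hum n) hC fun ω => hu ω n]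
    exact integral_mono (integrable_of_abs_le hF hFC)
      (integrable_limsupAverage hT.measurable (hum n) hC fun ω => hu ω n)
      fun ω => (hglb ω).1 ⟨n, hn, rfl⟩
  have hi1 := integrable_of_abs_le (μ := μ) hlow hlowC
  have hi2 := integrable_of_abs_le (μ := μ) hF hFC
  have heq := (integral_eq_iff_of_ae_le hi1 hi2 hle).1
    (le_antisymm (integral_mono_ae hi1 hi2 hle) hint)
  filter_upwards [heq, hupper] with ω h1 h2
  exact tendsto_of_le_liminf_of_limsup_le h1.ge h2 (isBoundedUnder_le_of_abs_le (hu ω))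
    (isBoundedUnder_ge_of_abs_le (hu ω))

end PointwiseErgodic

/-! ### Upper probabilities and the invariant probabilities they dominate. -/

variable {Ω : Type*} [MeasurableSpace Ω] {T : Ω → Ω} {V : Set Ω → ℝ}

theorem IsUpperProbability.exists_eq (hV : IsUpperProbability V) {A : Set Ω}
    (hA : MeasurableSet A) : ∃ P : ProbabilityMeasure Ω,
      (∀ B, MeasurableSet B → (P : Measure Ω).real B ≤ V B) ∧ (P : Measure Ω).real A = V A := by
  obtain ⟨-, Λ, -, hmax⟩ := hV
  obtain ⟨P, hP, hPA⟩ := (hmax A hA).1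
  exact ⟨P, fun B hB => (hmax B hB).2 ⟨P, hP, rfl⟩, hPA⟩

theorem IsUpperProbability.nonneg (hV : IsUpperProbability V) {A : Set Ω}
    (hA : MeasurableSet A) : 0 ≤ V A := by
  obtain ⟨P, -, h⟩ := hV.exists_eq hA
  exact h ▸ measureReal_nonneg

/-- An upper probability is continuous from above. -/
theorem IsUpperProbability.le_iInter (hV : IsUpperProbability V) {U : ℕ → Set Ω}
    (hU : ∀ n, MeasurableSet (U n)) (hanti : Antitone U) {c : ℝ} (hc : ∀ n, c ≤ V (U n)) :
    c ≤ V (⋂ n, U n) := by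
  obtain ⟨-, Λ, hΛ, hmax⟩ := hV
  let _ : TopologicalSpace (ProbabilityMeasure Ω) := weakStarTopology Ω
  have hcont : ∀ n, Continuous fun P : ProbabilityMeasure Ω => (P : Measure Ω).real (U n) :=
    fun n => (continuous_apply (⟨U n, hU n⟩ : {A : Set Ω // MeasurableSet A})).comp
      (f := fun (P : ProbabilityMeasure Ω) (A : {A : Set Ω // MeasurableSet A}) =>
        (P : Measure Ω).real A.1) continuous_induced_dom
  -- Finite intersection property: a maximiser for the smallest of finitely many `U n` works for all
  -- of them.
  obtain ⟨P, hP, hPU⟩ := hΛ.inter_iInter_nonempty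
    (fun n => {P : ProbabilityMeasure Ω | c ≤ (P : Measure Ω).real (U n)})
    (fun n => isClosed_le continuous_const (hcont n)) fun u => by
      obtain ⟨P, hP, hPV⟩ := (hmax _ (hU (u.sup id))).1
      refine ⟨P, hP, Set.mem_iInter₂.2 fun n hn => ?_⟩
      exact (hc _).trans (hPV.symm.le.trans
        (measureReal_mono (hanti (Finset.le_sup (f := id) hn))))
  have hlim : Tendsto (fun n => (P : Measure Ω).real (U n)) atTop
      (𝓝 ((P : Measure Ω).real (⋂ n, U n))) :=
    (ENNReal.tendsto_toReal (measure_ne_top _ _)).comp (tendsto_measure_iInter_atTop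
      (fun n => (hU n).nullMeasurableSet) hanti ⟨0, measure_ne_top _ _⟩)
  exact (ge_of_tendsto' hlim fun n => Set.mem_iInter.1 hPU n).trans
    ((hmax _ (MeasurableSet.iInter hU)).2 ⟨P, hP, rfl⟩)

theorem IsUpperProbability.tendsto_zero (hV : IsUpperProbability V) {U : ℕ → Set Ω}
    (hU : ∀ n, MeasurableSet (U n)) (hanti : Antitone U) (hempty : ⋂ n, U n = ∅) :
    Tendsto (fun n => V (U n)) atTop (𝓝 0) := by
  refine tendsto_order.2 ⟨fun a ha => Eventually.of_forall fun n => ha.trans_le (hV.nonneg (hU n)),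
    fun a ha => ?_⟩
  by_contra hcon
  have h : ∀ n, a ≤ V (U n) := fun n => by
    by_contra! hn
    exact hcon ((eventually_ge_atTop n).mono fun k hk =>
      (hV.1.mono _ _ (hU k) (hU n) (hanti hk)).trans_lt hn)
  have := hV.le_iInter hU hanti h
  rw [hempty, hV.1.empty] at this
  linarith

/-- A finitely additive probability dominated by an upper probability is a probability. -/
theorem IsUpperProbability.exists_probabilityMeasure (hV : IsUpperProbability V) {q : Set Ω → ℝ}
    (hq0 : ∀ A, 0 ≤ q A) (hq1 : q Set.univ = 1)
    (hqV : ∀ A, MeasurableSet A → q A ≤ V A)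
    (hadd : ∀ A B, MeasurableSet A → MeasurableSet B → Disjoint A B → q (A ∪ B) = q A + q B) :
    ∃ Q : ProbabilityMeasure Ω, ∀ A, MeasurableSet A → (Q : Measure Ω).real A = q A := by
  have hqe : q ∅ = 0 := le_antisymm (hV.1.empty ▸ hqV _ MeasurableSet.empty) (hq0 _)
  have hsum : ∀ s : ℕ → Set Ω, (∀ i, MeasurableSet (s i)) → Pairwise (Function.onFun Disjoint s) →
      HasSum (fun i => q (s i)) (q (⋃ i, s i)) := fun s hs hd => by
    rw [hasSum_iff_tendsto_nat_of_nonneg fun i => hq0 _]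
    set tail : ℕ → Set Ω := fun n => ⋃ i, ⋃ _ : n ≤ i, s i with htail
    have htm : ∀ n, MeasurableSet (tail n) := fun n =>
      MeasurableSet.iUnion fun i => MeasurableSet.iUnion fun _ => hs i
    have hstep : ∀ n, tail n = s n ∪ tail (n + 1) := fun n => by
      ext ω
      simp only [htail, Set.mem_iUnion, Set.mem_union, exists_prop]
      constructor
      · rintro ⟨i, hi, hω⟩
        rcases hi.eq_or_lt with rfl | hi
        · exact Or.inl hω
        · exact Or.inr ⟨i, hi, hω⟩
      · rintro (hω | ⟨i, hi, hω⟩)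
        · exact ⟨n, le_rfl, hω⟩
        · exact ⟨i, by omega, hω⟩
    have hdt : ∀ n, Disjoint (s n) (tail (n + 1)) := fun n => by
      simp only [htail, Set.disjoint_iUnion_right]
      exact fun i hi => hd (by omega)
    have hpart : ∀ n, ∑ i ∈ Finset.range n, q (s i) = q (⋃ i, s i) - q (tail n) := fun n => by
      induction n with
      | zero => simp [htail]
      | succ n ih =>
        rw [Finset.sum_range_succ, ih, hstep n, hadd _ _ (hs n) (htm _) (hdt n)]
        ring
    have hanti : Antitone tail := fun a b hab =>
      Set.iUnion_mono fun i => Set.iUnion_mono' fun h => ⟨hab.trans h, le_rfl⟩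
    have hemp : ⋂ n, tail n = ∅ := by
      refine Set.eq_empty_of_forall_notMem fun ω hω => ?_
      simp only [htail, Set.mem_iInter, Set.mem_iUnion, exists_prop] at hω
      obtain ⟨i, -, hi⟩ := hω 0
      obtain ⟨j, hj, hj'⟩ := hω (i + 1)
      exact Set.disjoint_left.1 (hd (show i ≠ j by omega)) hi hj'
    have h0 : Tendsto (fun n => q (tail n)) atTop (𝓝 0) :=
      squeeze_zero (fun n => hq0 _) (fun n => hqV _ (htm n)) (hV.tendsto_zero htm hanti hemp)
    simpa [hpart] using tendsto_const_nhds.sub h0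
  let Q : Measure Ω := Measure.ofMeasurable (fun A _ => ENNReal.ofReal (q A)) (by simp [hqe])
    fun s hs hd => by
      rw [← (hsum s hs hd).tsum_eq, ENNReal.ofReal_tsum_of_nonneg (fun i => hq0 _)
        (hsum s hs hd).summable]
  have hQ : ∀ A, MeasurableSet A → Q A = ENNReal.ofReal (q A) := fun A hA =>
    Measure.ofMeasurable_apply A hA
  refine ⟨⟨Q, ⟨by rw [hQ _ MeasurableSet.univ, hq1, ENNReal.ofReal_one]⟩⟩, fun A hA => ?_⟩
  change (Q A).toReal = q A
  rw [hQ A hA, ENNReal.toReal_ofReal (hq0 A)]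

/-- Every probability dominated by an invariant upper probability agrees on the invariant sets with
an invariant probability that is dominated as well. -/
theorem IsUpperProbability.exists_invariant (hV : IsUpperProbability V) (hT : Measurable T)
    (hVT : IsInvariant T V) {P : ProbabilityMeasure Ω}
    (hP : ∀ A, MeasurableSet A → (P : Measure Ω).real A ≤ V A) :
    ∃ Q ∈ invariantProbabilities T, (∀ A, MeasurableSet A → (Q : Measure Ω).real A ≤ V A) ∧
      ∀ A, MeasurableSet[MeasurableSpace.invariants T] A →
        (Q : Measure Ω).real A = (P : Measure Ω).real A := by
  set p : Set Ω → ℝ := (P : Measure Ω).real with hp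
  -- Averages of the push-forwards of `P`, read as Birkhoff averages of `p` for the map `A ↦ T ⁻¹'
  -- A` on sets.
  set a : ℕ → Set Ω → ℝ := fun n A => birkhoffAverage ℝ (Set.preimage T) p n A with ha
  have hp1 : ∀ A, |p A| ≤ 1 := fun A => by
    rw [abs_of_nonneg measureReal_nonneg]; exact measureReal_le_one
  have hsumnn : ∀ n A, 0 ≤ birkhoffSum (Set.preimage T) p n A := fun n A =>
    Finset.sum_nonneg fun i _ => measureReal_nonneg
  have ha0 : ∀ n A, 0 ≤ a n A := fun n A => by
    simp only [ha, birkhoffAverage_eq_div]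
    exact div_nonneg (hsumnn n A) (Nat.cast_nonneg n)
  -- A free ultrafilter gives a limit on all sets at once, preserving inequalities and finite sums.
  have hlim : ∀ A, ∃ x, Tendsto (fun n => a n A) (hyperfilter ℕ) (𝓝 x) := fun A => by
    have hmem : ∀ᶠ n in hyperfilter ℕ, a n A ∈ Set.Icc (-1 : ℝ) 1 := Eventually.of_forall fun n =>
      abs_le.1 (abs_birkhoffAverage_le zero_le_one hp1 A n)
    obtain ⟨x, -, hx⟩ := isCompact_Icc.ultrafilter_le_nhds' ((hyperfilter ℕ).map fun n => a n A) hmem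
    exact ⟨x, hx⟩
  choose q hq using hlim
  have hle : (hyperfilter ℕ : Filter ℕ) ≤ atTop := Nat.hyperfilter_le_atTop
  have hconst : ∀ A, (∀ i, p ((Set.preimage T)^[i] A) = p A) → q A = p A := fun A hA => by
    refine tendsto_nhds_unique (hq A) (tendsto_const_nhds.congr' (hle ?_))
    filter_upwards [eventually_ge_atTop 1] with n hn
    have hn0 : (n : ℝ) ≠ 0 := by positivity
    simp only [ha, birkhoffAverage_eq_div, birkhoffSum, hA]
    simp [hn0]
  have hpre : ∀ i A, MeasurableSet A → MeasurableSet ((Set.preimage T)^[i] A) := fun i A hA => by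
    rw [← Set.preimage_iterate_eq]; exact hT.iterate i hA
  have hVi : ∀ i A, MeasurableSet A → V ((Set.preimage T)^[i] A) = V A := fun i A hA => by
    induction i with
    | zero => rfl
    | succ i ih => rw [Function.iterate_succ_apply', ← hVT _ (hpre i A hA), ih]
  have hqV : ∀ A, MeasurableSet A → q A ≤ V A := fun A hA => by
    refine le_of_tendsto (hq A) (hle ?_)
    filter_upwards [eventually_ge_atTop 1] with n hn
    have hn0 : (0 : ℝ) < n := by exact_mod_cast hn
    simp only [ha, birkhoffAverage_eq_div, birkhoffSum]
    rw [div_le_iff₀ hn0, mul_comm]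
    simpa using Finset.sum_le_card_nsmul (Finset.range n) (fun i => p ((Set.preimage T)^[i] A))
      (V A) fun i _ => (hP _ (hpre i A hA)).trans_eq (hVi i A hA)
  have hadd : ∀ A B, MeasurableSet A → MeasurableSet B → Disjoint A B →
      q (A ∪ B) = q A + q B := fun A B _ hB hAB => by
    refine tendsto_nhds_unique (hq _) (((hq A).add (hq B)).congr fun n => ?_)
    simp only [ha, birkhoffAverage, birkhoffSum, ← smul_add, ← Finset.sum_add_distrib]
    congr 1
    refine Finset.sum_congr rfl fun i _ => ?_
    simp only [hp]
    rw [← measureReal_union (hd := ?_) (h := hpre i B hB)]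
    · simp only [← Set.preimage_iterate_eq, Set.preimage_union]
    · simp only [← Set.preimage_iterate_eq]
      exact hAB.preimage _
  have hqT : ∀ A, q (T ⁻¹' A) = q A := fun A => by
    have h := (tendsto_birkhoffAverage_apply_sub_birkhoffAverage' ℝ (g := p)
      ((Metric.isBounded_closedBall (x := (0 : ℝ)) (r := 1)).subset
        (Set.range_subset_iff.2 fun A => by simpa using hp1 A)) (Set.preimage T) A).mono_left hle
    exact sub_eq_zero.1 (tendsto_nhds_unique ((hq (T ⁻¹' A)).sub (hq A)) h)
  have hq1 : q Set.univ = 1 := by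
    rw [hconst, hp, probReal_univ]
    intro i
    rw [← Set.preimage_iterate_eq, Set.preimage_univ]
  obtain ⟨Q, hQ⟩ := hV.exists_probabilityMeasure (fun A => ge_of_tendsto' (hq A) fun n => ha0 n A)
    hq1 hqV hadd
  refine ⟨Q, fun A hA => ?_, fun A hA => (hQ A hA).trans_le (hqV A hA), fun A hA => ?_⟩
  · rw [← measureReal_eq_measureReal_iff, hQ _ (hT hA), hQ A hA, hqT]
  · have hA' := MeasurableSpace.measurableSet_invariants.1 hA
    rw [hQ A hA'.1]
    exact hconst A fun i => by rw [Function.iterate_fixed hA'.2]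

theorem measurePreserving_of_mem_invariantProbabilities (hT : Measurable T)
    {Q : ProbabilityMeasure Ω} (hQ : Q ∈ invariantProbabilities T) :
    MeasurePreserving T (Q : Measure Ω) Q :=
  ⟨hT, Measure.ext fun A hA => by rw [Measure.map_apply hT hA, hQ A hA]⟩

/-- The null sets of an invariant upper probability are determined by the invariant probabilities
it dominates. -/
theorem IsUpperProbability.eq_zero_of_forall_invariant (hV : IsUpperProbability V)
    (hT : Measurable T) (hVT : IsInvariant T V) {A : Set Ω} (hA : MeasurableSet A)
    (h : ∀ Q ∈ invariantProbabilities T, (∀ B, MeasurableSet B → (Q : Measure Ω).real B ≤ V B) →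
      (Q : Measure Ω) A = 0) : V A = 0 := by
  -- Points visiting `A` at some time at least `n`; the intersection, infinitely many visits, is
  -- exactly invariant.
  set U : ℕ → Set Ω := fun n => ⋃ k, ⋃ _ : n ≤ k, T^[k] ⁻¹' A with hU
  have hUm : ∀ n, MeasurableSet (U n) := fun n =>
    MeasurableSet.iUnion fun k => MeasurableSet.iUnion fun _ => hT.iterate k hA
  have hanti : Antitone U := fun a b hab =>
    Set.iUnion_mono fun i => Set.iUnion_mono' fun h => ⟨hab.trans h, le_rfl⟩
  have hmem : ∀ ω, ω ∈ ⋂ n, U n ↔ ∃ᶠ n in atTop, T^[n] ω ∈ A := fun ω => by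
    simp [hU, frequently_atTop]
  have hinv : MeasurableSet[MeasurableSpace.invariants T] (⋂ n, U n) := by
    refine MeasurableSpace.measurableSet_invariants.2 ⟨MeasurableSet.iInter hUm, ?_⟩
    ext ω
    rw [Set.mem_preimage, hmem, hmem]
    conv_rhs => rw [← map_add_atTop_eq_nat 1, frequently_map]
    rfl
  have hVn : ∀ n, V A = V (T^[n] ⁻¹' A) := fun n => by
    induction n with
    | zero => rfl
    | succ n ih =>
      rw [ih, hVT _ (hT.iterate n hA), ← Set.preimage_comp, ← Function.iterate_succ]
  have hle : V A ≤ V (⋂ n, U n) := hV.le_iInter hUm hanti fun n => by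
    rw [hVn n]
    exact hV.1.mono _ _ (hT.iterate n hA) (hUm n)
      (Set.subset_iUnion₂_of_subset n le_rfl subset_rfl)
  obtain ⟨P, hPV, hP⟩ := hV.exists_eq (MeasurableSet.iInter hUm)
  obtain ⟨Q, hQ, hQV, hQP⟩ := hV.exists_invariant hT hVT hPV
  have hQT := measurePreserving_of_mem_invariantProbabilities hT hQ
  have hQ0 : (Q : Measure Ω) (⋂ n, U n) = 0 := by
    refine measure_mono_null (Set.iInter_subset _ 0) (measure_iUnion_null fun k =>
      measure_iUnion_null fun _ => ?_)
    rw [(hQT.iterate k).measure_preimage hA.nullMeasurableSet]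
    exact h Q hQ hQV
  rw [← hP, ← hQP _ hinv, measureReal_def, hQ0, ENNReal.toReal_zero] at hle
  exact le_antisymm hle (hV.nonneg hA)

/-- For an ergodic upper probability, every function measurable for the invariant sets is almost
surely constant. -/
theorem IsUpperProbability.exists_almostSurely_eq_const (hV : IsUpperProbability V)
    (herg : IsErgodic T V) {g : Ω → ℝ} (hg : Measurable[MeasurableSpace.invariants T] g) :
    ∃ c : ℝ, AlmostSurely V fun ω => g ω = c := by
  have hle := MeasurableSpace.invariants_le T
  obtain ⟨P, hPV, -⟩ := hV.exists_eq MeasurableSet.univ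
  have hP0 : ∀ A, MeasurableSet A → V A = 0 → (P : Measure Ω) A = 0 := fun A hA h =>
    (measureReal_eq_zero_iff (μ := (P : Measure Ω))).1 (le_antisymm (h ▸ hPV A hA) measureReal_nonneg)
  obtain ⟨c, hc⟩ : ∃ c, g =ᵐ[(P : Measure Ω)] Function.const Ω c := by
    -- Any dominated `P` is trivial on invariant sets, so `g` is `P`-a.s. some `c`. Then `{g = c}`
    -- is not `V`-null, and ergodicity makes its complement `V`-null.
    refine exists_eventuallyEq_const_of_forall_separating MeasurableSet fun s hs => ?_
    rcases (herg.2 _ (hg hs)).2 with h | h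
    · exact Or.inr (measure_eq_zero_iff_ae_notMem.1 (hP0 _ (hle _ (hg hs)) h))
    · refine Or.inl ?_
      have := measure_eq_zero_iff_ae_notMem.1 (hP0 _ (hle _ (hg hs)).compl h)
      exact this.mono fun ω hω => not_not.1 hω
  have hm := hg (measurableSet_singleton c)
  refine ⟨c, g ⁻¹' {c}, hle _ hm, ?_, fun ω hω => hω⟩
  refine (herg.2 _ hm).2.resolve_left fun h => ?_
  have h1 := hP0 _ (hle _ hm) h
  have h2 : (P : Measure Ω) (g ⁻¹' {c})ᶜ = 0 := hc
  have h3 := prob_compl_eq_one_iff (μ := (P : Measure Ω)) (hle _ hm) |>.2 h1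
  simp [h2] at h3

theorem AlmostSurely.ae {p : Ω → Prop} (h : AlmostSurely V p) {Q : ProbabilityMeasure Ω}
    (hQ : ∀ A, MeasurableSet A → (Q : Measure Ω).real A ≤ V A) : ∀ᵐ ω ∂(Q : Measure Ω), p ω := by
  obtain ⟨A, hA, hVA, hp⟩ := h
  have h0 : (Q : Measure Ω) Aᶜ = 0 :=
    (measureReal_eq_zero_iff (μ := (Q : Measure Ω))).1 (le_antisymm (hVA ▸ hQ _ hA.compl) measureReal_nonneg)
  filter_upwards [measure_eq_zero_iff_ae_notMem.1 h0] with ω hω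
  exact hp ω (not_not.1 hω)

end UpperProb

/-! ### The subadditive ergodic theorem for upper probabilities. -/

theorem theorem7p1 {Ω : Type*} [MeasurableSpace Ω] [StandardBorelSpace Ω]
    (T : Ω → Ω) (hT : Measurable T)
    (V : Set Ω → ℝ) (hV : UpperProb.IsUpperProbability V) (hVT : UpperProb.IsInvariant T V)
    (f : ℕ → Ω → ℝ) (hf : ∀ n : ℕ, 1 ≤ n → Measurable (f n))
    (hbdd : ∃ lam : ℝ, 0 < lam ∧
      ∀ n : ℕ, 1 ≤ n → ∀ ω : Ω, -(lam * n) ≤ f n ω ∧ f n ω ≤ lam * n)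
    (hsub : UpperProb.IsSubadditiveSeq T V f) :
    ∃ (g : ℕ → Ω → ℝ) (fstar : Ω → ℝ),
      (∀ n : ℕ, 1 ≤ n →
        UpperProb.IsBoundedMeasurable (MeasurableSpace.invariants T) (g n) ∧
        UpperProb.IsCommonCondExp (MeasurableSpace.invariants T)
          (UpperProb.invariantProbabilities T) (fun ω => f n ω / n) (g n)) ∧
      (∀ ω : Ω, IsGLB ((fun n : ℕ => g n ω) '' Set.Ici 1) (fstar ω)) ∧
      UpperProb.IsBoundedMeasurable (MeasurableSpace.invariants T) fstar ∧
      UpperProb.AlmostSurely V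
        (fun ω => Tendsto (fun n : ℕ => f n ω / n) atTop (𝓝 (fstar ω))) ∧
      (UpperProb.IsErgodic T V →
        ∃ c : ℝ, UpperProb.AlmostSurely V (fun ω => fstar ω = c)) := by
  obtain ⟨C, hC, hb⟩ := hbdd
  have hb' : ∀ n, 1 ≤ n → ∀ ω, |f n ω| ≤ C * n := fun n hn ω => abs_le.2 (hb n hn ω)
  have hu : ∀ ω n, |f n ω / n| ≤ C := fun ω =>
    UpperProb.abs_div_natCast_le hC.le fun n hn => hb' n hn ω
  have hum := UpperProb.measurable_div_natCast hf
  let g : ℕ → Ω → ℝ := fun n => UpperProb.limsupAverage T fun ω => f n ω / n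
  have hgC : ∀ n ω, |g n ω| ≤ C := fun n =>
    UpperProb.abs_limsupAverage_le hC.le fun ω => hu ω n
  have hgm : ∀ n, Measurable[MeasurableSpace.invariants T] (g n) := fun n =>
    UpperProb.measurable_invariants_limsupAverage hT (hum n) hC.le fun ω => hu ω n
  let F : Ω → ℝ := fun ω => ⨅ n : ℕ, g (n + 1) ω
  have hglb : ∀ ω, IsGLB ((fun n : ℕ => g n ω) '' Set.Ici 1) (F ω) := fun ω => by
    have hset : (fun n : ℕ => g n ω) '' Set.Ici 1 = Set.range fun n : ℕ => g (n + 1) ω := by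
      ext x
      constructor
      · rintro ⟨n, hn, rfl⟩
        exact ⟨n - 1, by simp only [Nat.sub_add_cancel (Set.mem_Ici.1 hn)]⟩
      · rintro ⟨n, rfl⟩
        exact ⟨n + 1, Set.mem_Ici.2 (by omega), rfl⟩
    rw [hset]
    exact isGLB_ciInf ⟨-C, by rintro _ ⟨n, rfl⟩; exact (abs_le.1 (hgC _ _)).1⟩
  have hFm : Measurable[MeasurableSpace.invariants T] F :=
    Measurable.iInf (mδ := MeasurableSpace.invariants T) fun n => hgm (n + 1)
  have hFC : ∀ ω, |F ω| ≤ C := fun ω => abs_le.2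
    ⟨(hglb ω).2 (by rintro _ ⟨n, -, rfl⟩; exact (abs_le.1 (hgC _ _)).1),
      ((hglb ω).1 ⟨1, Set.mem_Ici.2 le_rfl, rfl⟩).trans (abs_le.1 (hgC 1 ω)).2⟩
  have hFm' : Measurable F := hFm.mono (MeasurableSpace.invariants_le T) le_rfl
  refine ⟨g, F, fun n _ => ⟨⟨hgm n, C, hgC n⟩, MeasurableSpace.invariants_le T, hgm n,
    fun P hP => UpperProb.condExp_invariants_ae_eq
      (UpperProb.measurePreserving_of_mem_invariantProbabilities hT hP) (hum n) hC.le
      fun ω => hu ω n⟩, hglb, ⟨hFm, C, hFC⟩, ?_,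
    fun herg => hV.exists_almostSurely_eq_const herg hFm⟩
  have hconv : MeasurableSet {ω | Tendsto (fun n : ℕ => f n ω / n) atTop (𝓝 (F ω))} :=
    measurableSet_tendsto_fun hum hFm'
  refine ⟨_, hconv, ?_, fun ω hω => hω⟩
  -- Only dominated `Q` are tested: `Q ≤ V` is what transfers the subadditivity from `V`-a.s. to
  -- `Q`-a.s.
  refine hV.eq_zero_of_forall_invariant hT hVT hconv.compl fun Q hQ hQV => ?_
  exact UpperProb.ae_tendsto_div_of_subadditive
    (UpperProb.measurePreserving_of_mem_invariantProbabilities hT hQ) hC.le hf hb'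
    (fun k n hk hn => (hsub k n hk hn).ae hQV) hFm' hFC hglb
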